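/- Let $d\ge 2$ and write $\mathcal L(\mathbb C^d)$ for the linear operators on $\mathbb C^d$, with identity $\mathbb 1$. A meter with finite outcome set $X$ is a map $\mathsf M:X\to\mathcal L(\mathbb C^d)$ with $\mathsf M(x)\ge 0$ for all $x$ and $\sum_x\mathsf M(x)=\mathbb 1$; it is sharp if every $\mathsf M(x)$ is a rank-one orthogonal projection. A channel is a linear completely positive map that sends states (positive semidefinite operators of trace one) to operators of trace one. An instrument is a map $\mathcal J:X\times\mathcal L(\mathbb C^d)\to\mathcal L(\mathbb C^d)$ such that each $\mathcal J(x,\cdot)$ is linear and completely positive and $\sum_x\mathcal J(x,\cdot)$ is a channel; $\mathcal J^\dagger$ is defined by $\mathrm{tr}(\varrho\,\mathcal J^\dagger(x,A))=\mathrm{tr}(\mathcal J(x,\varrho)A)$ for all $\varrho,A\in\mathcal L(\mathbb C^d)$. For $s,t\in[0,1]$ and a sharp meter $\mathsf Q$, put $\mathsf Q_s(x)=s\,\mathsf Q(x)+(1-s)\tfrac1d\mathbb 1$ and $I_t(\varrho)=t\varrho+(1-t)\tfrac1d\mathrm{tr}(\varrho)\mathbb 1$. The meter $\mathsf Q_s$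 and the channel $I_t$ are compatible if there is an instrument $\mathcal J$ with $\mathcal J^\dagger(x,\mathbb 1)=\mathsf Q_s(x)$ for all $x$ and $\sum_x\mathcal J(x,\cdot)=I_t$. The channels $I_s$ and $I_t$ are compatible if there is a channel $\Gamma:\mathcal L(\mathbb C^d)\to\mathcal L(\mathbb C^d\otimes\mathbb C^d)$ such that for every $\varrho\in\mathcal L(\mathbb C^d)$ the partial traces of $\Gamma(\varrho)$ over the second and over the first tensor factor are $I_s(\varrho)$ and $I_t(\varrho)$ respectively. Theorem. Let $\mathsf Q$ be any sharp meter in dimension $d\ge2$. (1) For all $s,t\in[0,1]$, the meter $\mathsf Q_s$ and the channel $I_t$ are compatible if and only if $$s+t-1\le\frac2d\sqrt{(1-s)(1-t)}.$$ (2) Consequently, the compatibility regions coincide: $$\{(s,t)\in[0,1]^2 \mid \mathsf Q_s\text{ and }I_t\text{ are compatible}\}=\{(s,t)\in[0,1]^2 \mid I_s\text{ and }I_t\text{ are compatible}\}.$$ -/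

import Mathlib

open scoped ComplexOrder CStarAlgebra

noncomputable section

namespace Qudit

/-! Operators on `ℂ^n` are the matrices `Matrix n n ℂ`; in particular `ℒ(ℂ^d)` is
`Matrix (Fin d) (Fin d) ℂ` and `ℒ(ℂ^d ⊗ ℂ^d)` is `Matrix (Fin d × Fin d) (Fin d × Fin d) ℂ`. -/

section General

variable {X m n n₁ n₂ : Type*} [Fintype X] [Fintype m] [DecidableEq m] [Fintype n] [DecidableEq n]
  [Fintype n₁] [DecidableEq n₁] [Fintype n₂] [DecidableEq n₂]

/-- A meter (POVM) with finite outcome set `X`. -/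
def IsMeter (M : X → Matrix n n ℂ) : Prop :=
  (∀ x, (M x).PosSemidef) ∧ ∑ x, M x = 1

/-- A sharp meter: a meter consisting of rank-one projections. -/
def IsSharpMeter (M : X → Matrix n n ℂ) : Prop :=
  IsMeter M ∧ ∀ x, IsStarProjection (M x) ∧ (M x).rank = 1

/-- A state: a positive semidefinite matrix of trace one. -/
def IsState (ρ : Matrix n n ℂ) : Prop :=
  ρ.PosSemidef ∧ ρ.trace = 1

/-- Complete positivity of a linear map between matrix algebras, the algebras being viewed as
C⋆-algebras. See `isCompletelyPositive_iff` for the description through positive semidefinite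
block matrices. -/
def IsCompletelyPositive (Φ : Matrix m m ℂ →ₗ[ℂ] Matrix n n ℂ) : Prop :=
  ∃ F : CStarMatrix m m ℂ →CP CStarMatrix n n ℂ,
    ∀ A : Matrix m m ℂ, F (CStarMatrix.ofMatrix A) = CStarMatrix.ofMatrix (Φ A)

theorem nonneg_iff_posSemidef_comp {k : Type*} [Fintype k]
    (N : CStarMatrix k k (CStarMatrix n n ℂ)) :
    0 ≤ N ↔ (Matrix.comp k k n n ℂ N).PosSemidef := by
  classical
  have key : ∀ B : CStarMatrix k k (CStarMatrix n n ℂ),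
      Matrix.comp k k n n ℂ (star B * B) =
        (Matrix.comp k k n n ℂ B).conjTranspose * Matrix.comp k k n n ℂ B := by
    intro B
    ext p q
    rw [Matrix.mul_apply, Fintype.sum_prod_type]
    have h₁ : (star B * B) p.1 q.1 = ∑ j, star B p.1 j * B j q.1 := CStarMatrix.mul_apply
    have h₂ : (∑ j, star B p.1 j * B j q.1) p.2 q.2 =
        ∑ j, (star B p.1 j * B j q.1) p.2 q.2 :=
      Matrix.sum_apply p.2 q.2 Finset.univ fun j => (star B p.1 j * B j q.1 : CStarMatrix n n ℂ)
    exact (congrArg (fun T : CStarMatrix n n ℂ => T p.2 q.2) h₁).trans h₂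
  constructor
  · intro h
    rw [StarOrderedRing.nonneg_iff] at h
    induction h using AddSubmonoid.closure_induction with
    | mem x hx =>
      obtain ⟨B, rfl⟩ := hx
      change (Matrix.comp k k n n ℂ (star B * B)).PosSemidef
      rw [key]
      exact Matrix.posSemidef_conjTranspose_mul_self _
    | zero => exact Matrix.PosSemidef.zero
    | add x y _ _ hx hy => exact hx.add hy
  · intro h
    open scoped MatrixOrder in
    obtain ⟨C, hC⟩ := (CStarAlgebra.nonneg_iff_eq_star_mul_self
      (a := Matrix.comp k k n n ℂ N)).1 (Matrix.nonneg_iff_posSemidef.2 h)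
    obtain ⟨B, rfl⟩ : ∃ B : CStarMatrix k k (CStarMatrix n n ℂ), Matrix.comp k k n n ℂ B = C :=
      ⟨(Matrix.comp k k n n ℂ).symm C, Equiv.apply_symm_apply _ _⟩
    have hN : N = star B * B :=
      (Matrix.comp k k n n ℂ).injective (hC.trans (key B).symm)
    rw [hN]
    exact star_mul_self_nonneg _

/-- `Φ` is completely positive if and only if, for all `k`, the map `id_k ⊗ Φ` sends positive
semidefinite block matrices to positive semidefinite block matrices. -/
theorem isCompletelyPositive_iff (Φ : Matrix m m ℂ →ₗ[ℂ] Matrix n n ℂ) :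
    IsCompletelyPositive Φ ↔ ∀ (k : ℕ) (A : Matrix (Fin k) (Fin k) (Matrix m m ℂ)),
      (Matrix.comp (Fin k) (Fin k) m m ℂ A).PosSemidef →
        (Matrix.comp (Fin k) (Fin k) n n ℂ (A.map Φ)).PosSemidef := by
  constructor
  · rintro ⟨F, hF⟩ k A hA
    have h := F.map_cstarMatrix_nonneg' k A ((nonneg_iff_posSemidef_comp (n := m) A).2 hA)
    have h' := (nonneg_iff_posSemidef_comp (n := n) _).1 h
    have e : A.map Φ = CStarMatrix.map A F.toLinearMap := by
      funext i j
      exact (hF (A i j)).symm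
    rw [e]
    exact h'
  · intro h
    refine ⟨⟨(CStarMatrix.ofMatrixₗ : Matrix n n ℂ ≃ₗ[ℂ] CStarMatrix n n ℂ).toLinearMap ∘ₗ Φ ∘ₗ
      (CStarMatrix.ofMatrixₗ : Matrix m m ℂ ≃ₗ[ℂ] CStarMatrix m m ℂ).symm.toLinearMap, ?_⟩, ?_⟩
    · intro k M hM
      exact (nonneg_iff_posSemidef_comp (n := n) _).2
        (h k M ((nonneg_iff_posSemidef_comp (n := m) M).1 hM))
    · intro A
      rfl

/-- A channel (Schrödinger picture). -/
def IsChannel (Φ : Matrix m m ℂ →ₗ[ℂ] Matrix n n ℂ) : Prop :=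
  IsCompletelyPositive Φ ∧ ∀ ρ, IsState ρ → (Φ ρ).trace = 1

/-- An instrument (Schrödinger picture) with finite outcome set `X`. -/
def IsInstrument (J : X → Matrix m m ℂ →ₗ[ℂ] Matrix n n ℂ) : Prop :=
  (∀ x, IsCompletelyPositive (J x)) ∧ IsChannel (∑ x, J x)

/-- The Heisenberg-picture adjoint `Φ†` of `Φ`; it is characterised by
`tr (ρ Φ†(A)) = tr (Φ(ρ) A)`, see `trace_mul_heisenberg` and `eq_heisenberg`. -/
def heisenberg (Φ : Matrix m m ℂ →ₗ[ℂ] Matrix n n ℂ) : Matrix n n ℂ →ₗ[ℂ] Matrix m m ℂ where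
  toFun A := Matrix.of fun i j => (Φ (Matrix.single j i 1) * A).trace
  map_add' A B := by
    ext i j
    simp [mul_add]
  map_smul' c A := by
    ext i j
    simp

theorem trace_mul_heisenberg (Φ : Matrix m m ℂ →ₗ[ℂ] Matrix n n ℂ) (ρ : Matrix m m ℂ)
    (A : Matrix n n ℂ) : (ρ * heisenberg Φ A).trace = (Φ ρ * A).trace := by
  conv_rhs => rw [Matrix.matrix_eq_sum_single ρ]
  simp only [map_sum, Finset.sum_mul, Matrix.trace_sum]
  rw [Matrix.trace]
  refine Finset.sum_congr rfl fun i _ => ?_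
  rw [Matrix.diag_apply, Matrix.mul_apply]
  refine Finset.sum_congr rfl fun j _ => ?_
  have e : Matrix.single i j (ρ i j) = ρ i j • Matrix.single i j (1 : ℂ) := by
    rw [Matrix.smul_single, smul_eq_mul, mul_one]
  rw [e, map_smul, Matrix.smul_mul, Matrix.trace_smul]
  rfl

theorem eq_heisenberg (Φ : Matrix m m ℂ →ₗ[ℂ] Matrix n n ℂ) (A : Matrix n n ℂ)
    (B : Matrix m m ℂ) (h : ∀ ρ, (ρ * B).trace = (Φ ρ * A).trace) :
    B = heisenberg Φ A := by
  ext i j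
  have := h (Matrix.single j i 1)
  rw [Matrix.trace_single_mul] at this
  simpa [heisenberg] using this

/-- `J` is a joint instrument for the meter `M` and the channel `Φ`:
`J†(x, 1) = M(x)` for all outcomes `x`, and `∑ x, J(x, ·) = Φ`. -/
def IsJointInstrument (J : X → Matrix m m ℂ →ₗ[ℂ] Matrix n n ℂ) (M : X → Matrix m m ℂ)
    (Φ : Matrix m m ℂ →ₗ[ℂ] Matrix n n ℂ) : Prop :=
  IsInstrument J ∧ (∀ x, heisenberg (J x) 1 = M x) ∧ ∑ x, J x = Φ

/-- A meter and a channel are compatible if they admit a joint instrument. -/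
def MeterChannelCompatible (M : X → Matrix m m ℂ) (Φ : Matrix m m ℂ →ₗ[ℂ] Matrix n n ℂ) : Prop :=
  ∃ J : X → Matrix m m ℂ →ₗ[ℂ] Matrix n n ℂ, IsJointInstrument J M Φ

/-- Partial trace over the second tensor factor. -/
def traceSnd (A : Matrix (n₁ × n₂) (n₁ × n₂) ℂ) : Matrix n₁ n₁ ℂ :=
  Matrix.of fun i j => ∑ k, A (i, k) (j, k)

/-- Partial trace over the first tensor factor. -/
def traceFst (A : Matrix (n₁ × n₂) (n₁ × n₂) ℂ) : Matrix n₂ n₂ ℂ :=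
  Matrix.of fun i j => ∑ k, A (k, i) (k, j)

/-- `Γ` is a joint channel for the channels `Φ₁` and `Φ₂`: its two marginals are `Φ₁` and `Φ₂`. -/
def IsJointChannel (Γ : Matrix m m ℂ →ₗ[ℂ] Matrix (n₁ × n₂) (n₁ × n₂) ℂ)
    (Φ₁ : Matrix m m ℂ →ₗ[ℂ] Matrix n₁ n₁ ℂ) (Φ₂ : Matrix m m ℂ →ₗ[ℂ] Matrix n₂ n₂ ℂ) : Prop :=
  IsChannel Γ ∧ (∀ ρ, traceSnd (Γ ρ) = Φ₁ ρ) ∧ (∀ ρ, traceFst (Γ ρ) = Φ₂ ρ)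

/-- Two channels are compatible if they admit a joint channel. -/
def ChannelsCompatible (Φ₁ : Matrix m m ℂ →ₗ[ℂ] Matrix n₁ n₁ ℂ)
    (Φ₂ : Matrix m m ℂ →ₗ[ℂ] Matrix n₂ n₂ ℂ) : Prop :=
  ∃ Γ : Matrix m m ℂ →ₗ[ℂ] Matrix (n₁ × n₂) (n₁ × n₂) ℂ, IsJointChannel Γ Φ₁ Φ₂

end General

/-- The noisy version `Q_s(x) = s Q(x) + (1 - s) (1/d) 𝟙` of a meter `Q`. -/
def noisyMeter {d : ℕ} {X : Type*} (Q : X → Matrix (Fin d) (Fin d) ℂ) (s : ℝ) :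
    X → Matrix (Fin d) (Fin d) ℂ :=
  fun x => (s : ℂ) • Q x + ((1 - s : ℂ) * (1 / d : ℂ)) • (1 : Matrix (Fin d) (Fin d) ℂ)

/-- The depolarizing channel `I_r(ρ) = r ρ + (1 - r) (1/d) tr(ρ) 𝟙`. -/
def depolarizing (d : ℕ) (r : ℝ) : Matrix (Fin d) (Fin d) ℂ →ₗ[ℂ] Matrix (Fin d) (Fin d) ℂ :=
  (r : ℂ) • LinearMap.id +
    ((1 - r : ℂ) * (1 / d : ℂ)) •
      (Matrix.traceLinearMap (Fin d) ℂ ℂ).smulRight (1 : Matrix (Fin d) (Fin d) ℂ)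

/-- The compatibility region of the pair `(Q, I)`. -/
def regionMeterIdentity {d : ℕ} {X : Type*} [Fintype X] (Q : X → Matrix (Fin d) (Fin d) ℂ) :
    Set (ℝ × ℝ) :=
  {p | p.1 ∈ Set.Icc (0 : ℝ) 1 ∧ p.2 ∈ Set.Icc (0 : ℝ) 1 ∧
    MeterChannelCompatible (noisyMeter Q p.1) (depolarizing d p.2)}

/-- The compatibility region of the pair `(I, I)` in dimension `d`. -/
def regionIdentityIdentity (d : ℕ) : Set (ℝ × ℝ) :=
  {p | p.1 ∈ Set.Icc (0 : ℝ) 1 ∧ p.2 ∈ Set.Icc (0 : ℝ) 1 ∧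
    ChannelsCompatible (depolarizing d p.1) (depolarizing d p.2)}

end Qudit

end

/-!
The theorem follows from the implications: inequality ⇒ `I_s`, `I_t` compatible ⇒ `Q_s`, `I_t`
compatible ⇒ inequality.

*Inequality ⇒ channels.* If `s + t ≤ 1`, the input can be sent to either output at random, or
discarded. Otherwise the asymmetric cloning map `cloner d a b`, which conjugates `ρ ⊗ 𝟙/d` by
`a 𝟙 + b SWAP`, with `a² = 1 - t` and `b² = 1 - s`, has marginals in which `ρ` has weight
`a² + 2ab/d`, respectively `b² + 2ab/d`. Mixing it with `cloner d a (-b)` reduces the interference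
term `2ab/d` to any smaller nonnegative number, in particular to `s + t - 1`, which is what
normalisation requires (`channelsCompatible_of_amplitudes`).

*Channels ⇒ meter and channel.* Measure `Q` on the first output of the joint channel
(`ChannelsCompatible.meterChannelCompatible`).

*Meter and channel ⇒ inequality.* Let `Q(x) = v_x v_x⋆`, and put
`C_x(i, j) = Re ⟨v_i, J_x(v_i v_j⋆) v_j⟩` for a joint instrument `J`. Complete positivity makes
the quadratic form of `C_x` nonnegative, so the Cauchy-Schwarz inequality `sum_choiRe_le` bounds
the sum of all entries by weighted diagonal entries; the weights are `1` at `i = x` and `1 + ν`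
elsewhere. The sum over `x` of `C_x(i, j)` is given by `I_t`, and the entries `C_x(i, i)` with
`i ≠ x` are at most `(1 - s)/d`, the probability that the noisy meter errs. This gives
`ν² (1 - s) - ν d (s + t - 1) + (1 - t) ≥ 0` for all `ν ≥ 0` (`IsSharpMeter.tradeoff`), and the
discriminant of this quadratic is the claim.
-/

/-! ### Completely positive maps -/

namespace Qudit

open Matrix

section CompletelyPositive

variable {ι l m n : Type*} [Fintype m] [DecidableEq m] [Fintype n] [DecidableEq n]
  [Fintype l] [DecidableEq l]

/-- The linear map `A ↦ K A K⋆` with the single Kraus operator `K`. -/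
def conjMap (K : Matrix n m ℂ) : Matrix m m ℂ →ₗ[ℂ] Matrix n n ℂ where
  toFun A := K * A * Kᴴ
  map_add' A B := by simp [Matrix.mul_add, Matrix.add_mul]
  map_smul' c A := by simp

theorem IsCompletelyPositive.add {Φ Ψ : Matrix m m ℂ →ₗ[ℂ] Matrix n n ℂ}
    (hΦ : IsCompletelyPositive Φ) (hΨ : IsCompletelyPositive Ψ) :
    IsCompletelyPositive (Φ + Ψ) := by
  rw [isCompletelyPositive_iff] at *
  exact fun k A hA => (hΦ k A hA).add (hΨ k A hA)

theorem IsCompletelyPositive.zero :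
    IsCompletelyPositive (0 : Matrix m m ℂ →ₗ[ℂ] Matrix n n ℂ) := by
  rw [isCompletelyPositive_iff]
  exact fun k A _ => Matrix.PosSemidef.zero

theorem IsCompletelyPositive.sum (s : Finset ι) {Φ : ι → Matrix m m ℂ →ₗ[ℂ] Matrix n n ℂ}
    (h : ∀ i, IsCompletelyPositive (Φ i)) : IsCompletelyPositive (∑ i ∈ s, Φ i) :=
  Finset.sum_induction _ _ (fun _ _ => IsCompletelyPositive.add) IsCompletelyPositive.zero
    fun i _ => h i

theorem IsCompletelyPositive.smul {Φ : Matrix m m ℂ →ₗ[ℂ] Matrix n n ℂ}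
    (hΦ : IsCompletelyPositive Φ) {r : ℝ} (hr : 0 ≤ r) : IsCompletelyPositive ((r : ℂ) • Φ) := by
  rw [isCompletelyPositive_iff] at *
  exact fun k A hA => (hΦ k A hA).smul (Complex.zero_le_real.2 hr)

theorem IsCompletelyPositive.comp {Ψ : Matrix m m ℂ →ₗ[ℂ] Matrix n n ℂ}
    {Φ : Matrix l l ℂ →ₗ[ℂ] Matrix m m ℂ}
    (hΨ : IsCompletelyPositive Ψ) (hΦ : IsCompletelyPositive Φ) :
    IsCompletelyPositive (Ψ ∘ₗ Φ) := by
  rw [isCompletelyPositive_iff] at *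
  exact fun k A hA => hΨ k _ (hΦ k A hA)

theorem isCompletelyPositive_conjMap (K : Matrix n m ℂ) : IsCompletelyPositive (conjMap K) := by
  rw [isCompletelyPositive_iff]
  intro k A hA
  -- `id_k ⊗ conjMap K` is conjugation by the block diagonal matrix with all blocks equal to `K`.
  convert hA.mul_mul_conjTranspose_same
    (Matrix.of fun (p : Fin k × n) (q : Fin k × m) => if p.1 = q.1 then K p.2 q.2 else 0) using 1
  ext ⟨a, i⟩ ⟨b, j⟩
  simp [Matrix.mul_apply, Fintype.sum_prod_type, conjMap, ite_mul, apply_ite]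

/-- The part of complete positivity that involves only two blocks, with the rank-one block
matrix `(u_a u_b⋆)` as input. -/
theorem IsCompletelyPositive.two_block_nonneg {Φ : Matrix m m ℂ →ₗ[ℂ] Matrix n n ℂ}
    (hΦ : IsCompletelyPositive Φ) (u : Fin 2 → m → ℂ) (y : Fin 2 → n → ℂ) :
    0 ≤ ∑ a, ∑ b, star (y a) ⬝ᵥ (Φ (vecMulVec (u a) (star (u b))) *ᵥ y b) := by
  have h := (isCompletelyPositive_iff Φ).1 hΦ 2
    (Matrix.of fun a b => vecMulVec (u a) (star (u b))) (by
      convert posSemidef_vecMulVec_self_star (fun p : Fin 2 × m => u p.1 p.2) using 1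
      rfl)
  have h2 := h.dotProduct_mulVec_nonneg (fun p : Fin 2 × n => y p.1 p.2)
  convert h2 using 1
  simp only [dotProduct, mulVec, Fintype.sum_prod_type, Finset.mul_sum]
  refine Finset.sum_congr rfl fun a _ => ?_
  rw [Finset.sum_comm]
  rfl

theorem IsCompletelyPositive.posSemidef {Φ : Matrix m m ℂ →ₗ[ℂ] Matrix n n ℂ}
    (hΦ : IsCompletelyPositive Φ) (u : m → ℂ) :
    (Φ (vecMulVec u (star u))).PosSemidef := by
  have h := (isCompletelyPositive_iff Φ).1 hΦ 1
    (Matrix.of fun _ _ => vecMulVec u (star u)) (by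
      convert posSemidef_vecMulVec_self_star (fun p : Fin 1 × m => u p.2) using 1
      rfl)
  exact h.submatrix fun i => ((0 : Fin 1), i)

end CompletelyPositive

/-! ### Sharp meters and orthonormal bases -/

section SharpMeter

variable {X n : Type*} [Fintype n]

/-- A rank-one projection is `v v⋆` for a unit vector `v`. -/
theorem exists_eq_vecMulVec [DecidableEq n] {P : Matrix n n ℂ} (hP : IsStarProjection P)
    (hr : P.rank = 1) :
    ∃ v : n → ℂ, P = vecMulVec v (star v) ∧ star v ⬝ᵥ v = 1 := by
  have hidem : P * P = P := hP.isIdempotentElem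
  have hherm : Pᴴ = P := hP.isSelfAdjoint
  obtain ⟨⟨w, hwr⟩, -, hw⟩ := finrank_eq_one_iff'.1 hr
  have hcol : ∀ j, ∃ c : ℂ, P.col j = c • w := fun j => by
    obtain ⟨c, hc⟩ := hw ⟨P.col j, Pi.single j 1, by simp⟩
    exact ⟨c, (congrArg Subtype.val hc).symm⟩
  choose c hc using hcol
  have hPwc : P = vecMulVec w c := by
    ext i j
    have := congrFun (hc j) i
    simpa [vecMulVec_apply, mul_comm] using this
  clear hw hwr hc
  -- `P = P P⋆` turns the factorisation `P = w cᵀ` into a Hermitian one.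
  obtain ⟨r, hr0, hrc⟩ : ∃ r : ℝ, 0 ≤ r ∧ c ⬝ᵥ star c = (r : ℂ) := by
    have h0 : 0 ≤ c ⬝ᵥ star c := dotProduct_comm (star c) c ▸ dotProduct_star_self_nonneg c
    refine ⟨(c ⬝ᵥ star c).re, (Complex.le_def.1 h0).1, ?_⟩
    apply Complex.ext <;> simp [← (Complex.le_def.1 h0).2]
  have hv : P = vecMulVec ((Real.sqrt r : ℂ) • w) (star ((Real.sqrt r : ℂ) • w)) := by
    have h1 : P = P * Pᴴ := by rw [hherm, hidem]
    rw [hPwc, conjTranspose_vecMulVec, vecMulVec_mul_vecMulVec, hrc] at h1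
    rw [hPwc, h1, star_smul, smul_vecMulVec, vecMulVec_smul, vecMulVec_smul, smul_smul]
    congr 1
    have : ((Real.sqrt r * Real.sqrt r : ℝ) : ℂ) = r := by rw [Real.mul_self_sqrt hr0]
    simpa using this.symm
  refine ⟨_, hv, ?_⟩
  set v := (Real.sqrt r : ℂ) • w
  have h2 : (star v ⬝ᵥ v) • P = P := by
    conv_rhs => rw [← hidem, hv, vecMulVec_mul_vecMulVec, vecMulVec_smul, ← hv]
  have hP0 : P ≠ 0 := by
    rintro rfl
    simp at hr
  exact (smul_left_injective ℂ hP0) (by simpa using h2)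

/-- The rank-one projections of a sharp meter come from an orthonormal family of vectors. -/
theorem IsSharpMeter.exists_vectors [Fintype X] [DecidableEq X] [DecidableEq n]
    {Q : X → Matrix n n ℂ} (hQ : IsSharpMeter Q) :
    ∃ v : X → n → ℂ, (∀ x, Q x = vecMulVec (v x) (star (v x))) ∧
      ∀ x y, star (v x) ⬝ᵥ v y = if x = y then 1 else 0 := by
  choose v hv hunit using fun x => exists_eq_vecMulVec (hQ.2 x).1 (hQ.2 x).2
  refine ⟨v, hv, fun x y => ?_⟩
  split_ifs with hxy
  · exact hxy ▸ hunit x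
  -- `v_x⋆ (∑ Q) v_x = 1` says that the `|⟨v_x, v_y⟩|²` add up to `1`, the term `y = x` alone.
  have hsum : ∑ y, Complex.normSq (star (v x) ⬝ᵥ v y) = 1 := by
    have h := congrArg (fun A => star (v x) ⬝ᵥ (A *ᵥ v x)) hQ.1.2
    simp only [one_mulVec, hunit, sum_mulVec, dotProduct_sum] at h
    have h3 : ∀ y, star (v x) ⬝ᵥ (Q y *ᵥ v x) = (Complex.normSq (star (v x) ⬝ᵥ v y) : ℂ) := by
      intro y
      rw [hv, vecMulVec_mulVec, op_smul_eq_smul, dotProduct_smul, smul_eq_mul,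
        Complex.normSq_eq_conj_mul_self]
      congr 1
      exact star_dotProduct _ _
    simp only [h3] at h
    exact_mod_cast h
  rw [← Finset.add_sum_erase _ _ (Finset.mem_univ x), hunit, Complex.normSq_one] at hsum
  have h0 := (Finset.sum_eq_zero_iff_of_nonneg
    (fun y _ => Complex.normSq_nonneg (star (v x) ⬝ᵥ v y))).1 (by linarith) y
    (Finset.mem_erase.2 ⟨Ne.symm hxy, Finset.mem_univ y⟩)
  exact Complex.normSq_eq_zero.1 h0

theorem IsSharpMeter.card_eq [Fintype X] [DecidableEq n] {Q : X → Matrix n n ℂ}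
    (hQ : IsSharpMeter Q) : Fintype.card X = Fintype.card n := by
  classical
  obtain ⟨v, hv, hon⟩ := hQ.exists_vectors
  have h := congrArg Matrix.trace hQ.1.2
  have h1 : ∀ x, (Q x).trace = 1 := fun x => by
    rw [hv, trace_vecMulVec, dotProduct_comm, hon, if_pos rfl]
  rw [Matrix.trace_sum] at h
  simp only [h1, Matrix.trace_one, Finset.sum_const, Finset.card_univ, nsmul_eq_mul, mul_one] at h
  exact_mod_cast h

end SharpMeter

end Qudit

/-! ### Asymmetric cloning: sufficiency for a pair of depolarizing channels -/

namespace Qudit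

open Matrix

section Cloning

/-- The (unnormalised) asymmetric cloning map
`ρ ↦ (1/d) (a 𝟙 + b SWAP) (ρ ⊗ 𝟙) (a 𝟙 + b SWAP)` for real amplitudes `a`, `b`; its Kraus
operators are `d^(-1/2) (a 𝟙 + b SWAP) (· ⊗ e_k)`. -/
noncomputable def cloner (d : ℕ) (a b : ℝ) :
    Matrix (Fin d) (Fin d) ℂ →ₗ[ℂ] Matrix (Fin d × Fin d) (Fin d × Fin d) ℂ :=
  ((1 / d : ℝ) : ℂ) • ∑ k, conjMap (Matrix.of fun (p : Fin d × Fin d) l =>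
    (if p.1 = l then (if p.2 = k then (a : ℂ) else 0) else 0) +
      (if p.2 = l then (if p.1 = k then (b : ℂ) else 0) else 0))

theorem isCompletelyPositive_cloner (d : ℕ) (a b : ℝ) : IsCompletelyPositive (cloner d a b) :=
  (IsCompletelyPositive.sum _ fun _ => isCompletelyPositive_conjMap _).smul (by positivity)

theorem cloner_apply (d : ℕ) (a b : ℝ) (ρ : Matrix (Fin d) (Fin d) ℂ) (i j i' j' : Fin d) :
    cloner d a b ρ (i, j) (i', j') = (1 / d : ℂ) *
      (a ^ 2 * (if j = j' then ρ i i' else 0) + a * b * (if j = i' then ρ i j' else 0) +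
        a * b * (if i = j' then ρ j i' else 0) + b ^ 2 * (if i = i' then ρ j j' else 0)) := by
  have h : ∀ k : Fin d, (conjMap (Matrix.of fun (p : Fin d × Fin d) l =>
      (if p.1 = l then (if p.2 = k then (a : ℂ) else 0) else 0) +
        (if p.2 = l then (if p.1 = k then (b : ℂ) else 0) else 0)) ρ) (i, j) (i', j') =
      (if j' = k then a * ((if j = k then a * ρ i i' else 0) + if i = k then b * ρ j i' else 0)
        else 0) +
      (if i' = k then b * ((if j = k then a * ρ i j' else 0) + if i = k then b * ρ j j' else 0)
        else 0) := by
    intro k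
    have hstar : ∀ (P : Prop) [Decidable P] (z : ℂ),
        star (if P then z else 0) = if P then star z else 0 := by
      intro P _ z; split_ifs <;> simp
    simp only [conjMap, LinearMap.coe_mk, AddHom.coe_mk, Matrix.mul_apply, conjTranspose_apply,
      Matrix.of_apply, star_add, hstar, add_mul, mul_add, Finset.sum_add_distrib, ite_mul, mul_ite,
      zero_mul, mul_zero, Finset.sum_ite_eq, Finset.mem_univ, if_true, RCLike.star_def,
      Complex.conj_ofReal]
    split_ifs <;> ring
  simp only [cloner, LinearMap.smul_apply, LinearMap.sum_apply, Matrix.smul_apply,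
    Matrix.sum_apply, h, Finset.sum_add_distrib, Finset.sum_ite_eq, Finset.mem_univ, if_true,
    smul_eq_mul]
  push_cast
  congr 1
  split_ifs <;> ring

theorem depolarizing_apply (d : ℕ) (r : ℝ) (ρ : Matrix (Fin d) (Fin d) ℂ) :
    depolarizing d r ρ = (r : ℂ) • ρ + ((1 - r : ℂ) * (1 / d : ℂ)) • ρ.trace • 1 := rfl

theorem depolarizing_trace {d : ℕ} (hd : d ≠ 0) (r : ℝ) (ρ : Matrix (Fin d) (Fin d) ℂ) :
    (depolarizing d r ρ).trace = ρ.trace := by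
  have : (d : ℂ) ≠ 0 := Nat.cast_ne_zero.2 hd
  simp only [depolarizing_apply, trace_add, trace_smul, trace_one, Fintype.card_fin, smul_eq_mul]
  field_simp
  ring

theorem traceSnd_cloner {d : ℕ} (hd : d ≠ 0) (a b : ℝ) (ρ : Matrix (Fin d) (Fin d) ℂ) :
    traceSnd (cloner d a b ρ) =
      (a ^ 2 + 2 * a * b / d : ℂ) • ρ + (b ^ 2 / d : ℂ) • ρ.trace • 1 := by
  have : (d : ℂ) ≠ 0 := Nat.cast_ne_zero.2 hd
  ext i j
  by_cases hij : i = j <;>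
  simp [traceSnd, cloner_apply, ← Finset.mul_sum, Finset.sum_add_distrib, hij,
    Matrix.trace] <;>
  field_simp <;> ring

theorem traceFst_cloner {d : ℕ} (hd : d ≠ 0) (a b : ℝ) (ρ : Matrix (Fin d) (Fin d) ℂ) :
    traceFst (cloner d a b ρ) =
      (b ^ 2 + 2 * a * b / d : ℂ) • ρ + (a ^ 2 / d : ℂ) • ρ.trace • 1 := by
  have : (d : ℂ) ≠ 0 := Nat.cast_ne_zero.2 hd
  ext i j
  by_cases hij : i = j <;>
  simp [traceFst, cloner_apply, ← Finset.mul_sum, Finset.sum_add_distrib, hij,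
    Matrix.trace] <;>
  field_simp <;> ring

/-- The (unnormalised) map `ρ ↦ tr(ρ) 𝟙`, which discards its input and prepares the maximally
mixed state. -/
noncomputable def discard (d : ℕ) :
    Matrix (Fin d) (Fin d) ℂ →ₗ[ℂ] Matrix (Fin d × Fin d) (Fin d × Fin d) ℂ :=
  ∑ p, ∑ l, conjMap (Matrix.single p l 1)

theorem discard_apply (d : ℕ) (ρ : Matrix (Fin d) (Fin d) ℂ) :
    discard d ρ = ρ.trace • 1 := by
  have h : ∀ p : Fin d × Fin d, ∀ l, conjMap (Matrix.single p l 1) ρ =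
      ρ l l • Matrix.single p p 1 := fun p l => by
    simp [conjMap, Matrix.single_mul_mul_single]
  simp only [discard, LinearMap.sum_apply, h, ← Finset.sum_smul]
  rw [← Finset.smul_sum, Matrix.sum_single_one]
  rfl

theorem isCompletelyPositive_discard (d : ℕ) : IsCompletelyPositive (discard d) :=
  IsCompletelyPositive.sum _ fun _ => IsCompletelyPositive.sum _ fun _ =>
    isCompletelyPositive_conjMap _

theorem traceSnd_discard (d : ℕ) (ρ : Matrix (Fin d) (Fin d) ℂ) :
    traceSnd (discard d ρ) = (d : ℂ) • ρ.trace • 1 := by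
  ext i j
  by_cases hij : i = j <;> simp [traceSnd, discard_apply, hij]

theorem traceFst_discard (d : ℕ) (ρ : Matrix (Fin d) (Fin d) ℂ) :
    traceFst (discard d ρ) = (d : ℂ) • ρ.trace • 1 := by
  ext i j
  by_cases hij : i = j <;> simp [traceFst, discard_apply, hij]

/-- Mixing the cloning maps with amplitudes `(a, b)` and `(a, -b)` damps the interference term
`2ab/d` by the factor `p - q`; the weight `w` adds noise to both clones. -/
theorem channelsCompatible_of_amplitudes {d : ℕ} (hd : d ≠ 0) {s t a b p q w : ℝ}
    (hp : 0 ≤ p) (hq : 0 ≤ q) (hw : 0 ≤ w) (hpq : p + q = 1)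
    (hs : s = a ^ 2 + (p - q) * (2 * a * b / d)) (ht : t = b ^ 2 + (p - q) * (2 * a * b / d))
    (h1 : a ^ 2 + b ^ 2 + (p - q) * (2 * a * b / d) + w = 1) :
    ChannelsCompatible (depolarizing d s) (depolarizing d t) := by
  have hdc : (d : ℂ) ≠ 0 := Nat.cast_ne_zero.2 hd
  set Γ := (p : ℂ) • cloner d a b + (q : ℂ) • cloner d a (-b) +
    ((w / d ^ 2 : ℝ) : ℂ) • discard d with hΓ
  have hcp : IsCompletelyPositive Γ :=
    (((isCompletelyPositive_cloner d a b).smul hp).add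
      ((isCompletelyPositive_cloner d a (-b)).smul hq)).add
      ((isCompletelyPositive_discard d).smul (by positivity))
  obtain rfl : q = 1 - p := by linarith
  obtain rfl : w = 1 - (a ^ 2 + b ^ 2 + (p - (1 - p)) * (2 * a * b / d)) := by linarith
  have hsnd : ∀ ρ, traceSnd (Γ ρ) = depolarizing d s ρ := fun ρ => by
    have hlin : traceSnd (Γ ρ) = (p : ℂ) • traceSnd (cloner d a b ρ) +
        ((1 - p : ℝ) : ℂ) • traceSnd (cloner d a (-b) ρ) + (((1 - (a ^ 2 + b ^ 2 +
          (p - (1 - p)) * (2 * a * b / d))) / d ^ 2 : ℝ) : ℂ) • traceSnd (discard d ρ) := by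
      ext i j
      simp [traceSnd, hΓ, Finset.sum_add_distrib, Finset.mul_sum]
    rw [hlin, traceSnd_cloner hd, traceSnd_cloner hd, traceSnd_discard, depolarizing_apply, hs]
    push_cast
    match_scalars <;> field_simp <;> ring
  have hfst : ∀ ρ, traceFst (Γ ρ) = depolarizing d t ρ := fun ρ => by
    have hlin : traceFst (Γ ρ) = (p : ℂ) • traceFst (cloner d a b ρ) +
        ((1 - p : ℝ) : ℂ) • traceFst (cloner d a (-b) ρ) + (((1 - (a ^ 2 + b ^ 2 +
          (p - (1 - p)) * (2 * a * b / d))) / d ^ 2 : ℝ) : ℂ) • traceFst (discard d ρ) := by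
      ext i j
      simp [traceFst, hΓ, Finset.sum_add_distrib, Finset.mul_sum]
    rw [hlin, traceFst_cloner hd, traceFst_cloner hd, traceFst_discard, depolarizing_apply, ht]
    push_cast
    match_scalars <;> field_simp <;> ring
  refine ⟨Γ, ⟨hcp, fun ρ hρ => ?_⟩, hsnd, hfst⟩
  have htr : (Γ ρ).trace = (traceSnd (Γ ρ)).trace := by
    simp [Matrix.trace, traceSnd, Fintype.sum_prod_type]
  rw [htr, hsnd, depolarizing_trace hd, hρ.2]

theorem channelsCompatible_depolarizing {d : ℕ} (hd : d ≠ 0) {s t : ℝ}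
    (hs : s ∈ Set.Icc (0 : ℝ) 1) (ht : t ∈ Set.Icc (0 : ℝ) 1)
    (h : s + t - 1 ≤ 2 / (d : ℝ) * Real.sqrt ((1 - s) * (1 - t))) :
    ChannelsCompatible (depolarizing d s) (depolarizing d t) := by
  obtain ⟨hs0, hs1⟩ := hs
  obtain ⟨ht0, ht1⟩ := ht
  have hd0 : (0 : ℝ) < d := by positivity
  rcases le_or_gt (s + t) 1 with hst | hst
  · -- No interference is needed: route the input to either output, or discard it.
    refine channelsCompatible_of_amplitudes hd (a := √s) (b := √t) (p := 1 / 2) (q := 1 / 2)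
      (w := 1 - s - t) (by norm_num) (by norm_num) (by linarith) (by norm_num) ?_ ?_ ?_ <;>
      rw [Real.sq_sqrt (by assumption)] <;> try rw [Real.sq_sqrt (by assumption)]
    all_goals ring
  · -- With `a² = 1 - t`, `b² = 1 - s` the hypothesis says that the required interference term
    -- `s + t - 1` is at most `2ab/d`.
    set a := √(1 - t) with ha
    set b := √(1 - s) with hb
    have ha2 : a ^ 2 = 1 - t := Real.sq_sqrt (by linarith)
    have hb2 : b ^ 2 = 1 - s := Real.sq_sqrt (by linarith)
    rw [Real.sqrt_mul (by linarith), ← ha, ← hb] at h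
    set c := 2 * a * b / (d : ℝ) with hc
    have hcst : s + t - 1 ≤ c := by rw [hc]; convert h using 1; ring
    have hc0 : 0 < c := by linarith
    have hr : (s + t - 1) / c ≤ 1 := (div_le_one hc0).2 hcst
    have hr0 : 0 ≤ (s + t - 1) / c := div_nonneg (by linarith) hc0.le
    have hrc : ((1 + (s + t - 1) / c) / 2 - (1 - (s + t - 1) / c) / 2) * c = s + t - 1 := by
      field_simp
      ring
    refine channelsCompatible_of_amplitudes hd (a := a) (b := b)
      (p := (1 + (s + t - 1) / c) / 2) (q := (1 - (s + t - 1) / c) / 2) (w := 0)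
      (by linarith) (by linarith) le_rfl (by ring) ?_ ?_ ?_ <;>
      rw [← hc, hrc] <;> linarith

end Cloning

/-! ### From joint channels to joint instruments -/

section Measure

variable {X n n₁ n₂ : Type*} [Fintype X] [Fintype n₁] [Fintype n₂] [DecidableEq n₂]

/-- The operator `v⋆ ⊗ 𝟙`, which applies the functional `⟨v, ·⟩` to the first tensor factor. -/
def braFst (v : n₁ → ℂ) : Matrix n₂ (n₁ × n₂) ℂ :=
  Matrix.of fun i p => if i = p.2 then star (v p.1) else 0

theorem conjMap_braFst_apply (v : n₁ → ℂ) (G : Matrix (n₁ × n₂) (n₁ × n₂) ℂ) (i j : n₂) :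
    conjMap (braFst v) G i j = ∑ k, ∑ l, G (k, i) (l, j) * (v l * star (v k)) := by
  simp only [conjMap, braFst, LinearMap.coe_mk, AddHom.coe_mk, Matrix.mul_apply,
    conjTranspose_apply, Matrix.of_apply, Fintype.sum_prod_type, ite_mul, zero_mul,
    Finset.sum_ite_eq, Finset.mem_univ, if_true, apply_ite star, star_star, star_zero, mul_ite,
    mul_zero, Finset.sum_mul]
  rw [Finset.sum_comm]
  refine Finset.sum_congr rfl fun k _ => Finset.sum_congr rfl fun l _ => ?_
  ring

/-- Measuring a meter of rank-one effects on the first output of a joint channel of `Φ₁` and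
`Φ₂` gives a joint instrument for the meter `Φ₁†(M)` and the channel `Φ₂`. -/
theorem ChannelsCompatible.meterChannelCompatible [DecidableEq n₁] [Fintype n] [DecidableEq n]
    {Φ₁ : Matrix n n ℂ →ₗ[ℂ] Matrix n₁ n₁ ℂ} {Φ₂ : Matrix n n ℂ →ₗ[ℂ] Matrix n₂ n₂ ℂ}
    (h : ChannelsCompatible Φ₁ Φ₂) (v : X → n₁ → ℂ)
    (hv : ∑ x, vecMulVec (v x) (star (v x)) = 1) :
    MeterChannelCompatible (fun x => heisenberg Φ₁ (vecMulVec (v x) (star (v x)))) Φ₂ := by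
  obtain ⟨Γ, ⟨hΓcp, hΓtr⟩, h1, h2⟩ := h
  have hcp : ∀ x, IsCompletelyPositive (conjMap (braFst (n₂ := n₂) (v x)) ∘ₗ Γ) :=
    fun x => (isCompletelyPositive_conjMap _).comp hΓcp
  have hsum : ∑ x, conjMap (braFst (n₂ := n₂) (v x)) ∘ₗ Γ = Φ₂ := by
    ext1 ρ
    rw [← h2]
    ext i j
    simp only [LinearMap.sum_apply, Matrix.sum_apply, LinearMap.comp_apply, conjMap_braFst_apply]
    rw [Finset.sum_comm]
    simp only [traceFst, Matrix.of_apply]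
    refine Finset.sum_congr rfl fun k _ => ?_
    rw [Finset.sum_comm]
    have hv' : ∀ l, ∑ x, v x l * star (v x k) = if l = k then 1 else 0 := fun l => by
      have := congrFun (congrFun hv l) k
      simpa [Matrix.sum_apply, vecMulVec_apply, Matrix.one_apply] using this
    simp only [← Finset.mul_sum, hv', mul_ite, mul_one, mul_zero, Finset.sum_ite_eq',
      Finset.mem_univ, if_true]
  refine ⟨fun x => conjMap (braFst (v x)) ∘ₗ Γ, ⟨hcp, ?_⟩, fun x => ?_, hsum⟩
  · refine ⟨IsCompletelyPositive.sum _ hcp, fun ρ hρ => ?_⟩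
    rw [hsum, ← h2, ← hΓtr ρ hρ]
    simp [Matrix.trace, traceFst, Fintype.sum_prod_type_right]
  · refine (eq_heisenberg _ _ _ fun ρ => ?_).symm
    rw [trace_mul_heisenberg, ← h1, mul_one]
    simp only [Matrix.trace, Matrix.diag_apply, LinearMap.comp_apply, conjMap_braFst_apply,
      Matrix.mul_apply, traceSnd, Matrix.of_apply, vecMulVec_apply, Finset.sum_mul, Pi.star_apply]
    symm
    rw [Finset.sum_comm]
    refine Finset.sum_congr rfl fun k _ => ?_
    rw [Finset.sum_comm]

end Measure

theorem heisenberg_depolarizing {d : ℕ} (s : ℝ) (A : Matrix (Fin d) (Fin d) ℂ) :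
    heisenberg (depolarizing d s) A = depolarizing d s A := by
  refine (eq_heisenberg _ _ _ fun ρ => ?_).symm
  simp only [depolarizing_apply, Matrix.mul_add, Matrix.add_mul, Matrix.mul_smul, Matrix.smul_mul,
    trace_add, trace_smul, Matrix.mul_one, Matrix.one_mul, smul_eq_mul]
  ring

theorem IsSharpMeter.meterChannelCompatible_of_channelsCompatible {d : ℕ} {X : Type*} [Fintype X]
    {Q : X → Matrix (Fin d) (Fin d) ℂ} (hQ : IsSharpMeter Q) {s t : ℝ}
    (h : ChannelsCompatible (depolarizing d s) (depolarizing d t)) :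
    MeterChannelCompatible (noisyMeter Q s) (depolarizing d t) := by
  classical
  obtain ⟨v, hv, hon⟩ := hQ.exists_vectors
  have hsum := hQ.1.2
  simp only [hv] at hsum
  convert h.meterChannelCompatible v hsum using 2 with x
  rw [heisenberg_depolarizing, depolarizing_apply, trace_vecMulVec, dotProduct_comm, hon,
    if_pos rfl, one_smul, noisyMeter, hv]

end Qudit

/-! ### The trade-off inequality: necessity for a sharp meter -/

namespace Qudit

open Matrix

section Necessity

variable {X n : Type*} [Fintype n]

/-- The matrix `C(i, j) = ⟨v_i, Φ(v_i v_j⋆) v_j⟩` of real parts: the compression of the Choi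
matrix of `Φ` to the vectors `v_i ⊗ v_i`. -/
noncomputable def choiRe (v : X → n → ℂ) (Φ : Matrix n n ℂ →ₗ[ℂ] Matrix n n ℂ) (i j : X) : ℝ :=
  (star (v i) ⬝ᵥ (Φ (vecMulVec (v i) (star (v j))) *ᵥ v j)).re

theorem choiRe_sum [Fintype X] (v : X → n → ℂ) (J : X → Matrix n n ℂ →ₗ[ℂ] Matrix n n ℂ)
    (i j : X) : choiRe v (∑ x, J x) i j = ∑ x, choiRe v (J x) i j := by
  simp [choiRe, LinearMap.sum_apply, Matrix.sum_mulVec, dotProduct_sum, Complex.re_sum]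

theorem choiRe_pair_le [DecidableEq n] {v : X → n → ℂ} {Φ : Matrix n n ℂ →ₗ[ℂ] Matrix n n ℂ}
    (hΦ : IsCompletelyPositive Φ) (α β : ℝ) (i j : X) :
    α * β * (choiRe v Φ i j + choiRe v Φ j i) ≤
      α ^ 2 * choiRe v Φ i i + β ^ 2 * choiRe v Φ j j := by
  have h := hΦ.two_block_nonneg ![v i, v j] ![(α : ℂ) • v i, (-β : ℂ) • v j]
  have h2 := (Complex.le_def.1 h).1
  simp only [Fin.sum_univ_two, Matrix.cons_val_zero, Matrix.cons_val_one, star_smul,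
    smul_dotProduct, dotProduct_smul, mulVec_smul, RCLike.star_def, Complex.conj_ofReal,
    smul_eq_mul, ← Complex.ofReal_neg, Complex.add_re, Complex.re_ofReal_mul, Complex.zero_re] at h2
  simp only [choiRe]
  nlinarith [h2]

/-- Cauchy-Schwarz with weights `r`, for the positive semidefinite matrix `choiRe v Φ`. -/
theorem sum_choiRe_le [Fintype X] [DecidableEq n] {v : X → n → ℂ}
    {Φ : Matrix n n ℂ →ₗ[ℂ] Matrix n n ℂ}
    (hΦ : IsCompletelyPositive Φ) {r : X → ℝ} (hr : ∀ i, 0 < r i) :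
    ∑ i, ∑ j, choiRe v Φ i j ≤ (∑ j, (r j)⁻¹) * ∑ i, r i * choiRe v Φ i i := by
  have hpair : ∀ i j, choiRe v Φ i j + choiRe v Φ j i ≤
      (r j)⁻¹ * (r i * choiRe v Φ i i) + (r i)⁻¹ * (r j * choiRe v Φ j j) := by
    intro i j
    have hi := hr i
    have hj := hr j
    have h := choiRe_pair_le (v := v) hΦ (r i) (r j) i j
    have e : (r j)⁻¹ * (r i * choiRe v Φ i i) + (r i)⁻¹ * (r j * choiRe v Φ j j) =
        (r i ^ 2 * choiRe v Φ i i + r j ^ 2 * choiRe v Φ j j) / (r i * r j) := by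
      field_simp
    rw [e, le_div_iff₀ (by positivity)]
    linarith
  have hsum := Finset.sum_le_sum fun i (_ : i ∈ Finset.univ) =>
    Finset.sum_le_sum fun j (_ : j ∈ Finset.univ) => hpair i j
  simp only [Finset.sum_add_distrib] at hsum
  rw [Finset.sum_comm (f := fun i j => choiRe v Φ j i),
    Finset.sum_comm (f := fun i j => (r j)⁻¹ * (r i * choiRe v Φ i i))] at hsum
  simp only [← Finset.mul_sum, ← Finset.sum_mul] at hsum
  linarith

/-- The diagonal of `choiRe` is bounded by the outcome probabilities. -/
theorem choiRe_diag_le [DecidableEq n] {v : X → n → ℂ} {Φ : Matrix n n ℂ →ₗ[ℂ] Matrix n n ℂ}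
    (hΦ : IsCompletelyPositive Φ) {i : X} (hv : star (v i) ⬝ᵥ v i = 1) :
    choiRe v Φ i i ≤ (star (v i) ⬝ᵥ (heisenberg Φ 1 *ᵥ v i)).re := by
  set P := vecMulVec (v i) (star (v i)) with hP
  have hPP : P * P = P := by
    rw [hP, vecMulVec_mul_vecMulVec, hv, one_smul]
  have hPh : Pᴴ = P := by rw [hP, conjTranspose_vecMulVec, star_star]
  have e1 : star (v i) ⬝ᵥ (heisenberg Φ 1 *ᵥ v i) = (Φ P).trace := by
    have := trace_mul_heisenberg Φ P 1
    rw [mul_one] at this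
    rw [← this, hP, vecMulVec_mul, trace_vecMulVec, dotProduct_mulVec, dotProduct_comm]
  have e2 : star (v i) ⬝ᵥ (Φ P *ᵥ v i) = (P * Φ P).trace := by
    rw [hP, vecMulVec_mul, trace_vecMulVec, dotProduct_mulVec, dotProduct_comm]
  have h := ((hΦ.posSemidef (v i)).conjTranspose_mul_mul_same (1 - P)).trace_nonneg
  have e3 : ((1 - P)ᴴ * Φ P * (1 - P)).trace = (Φ P).trace - (P * Φ P).trace := by
    rw [conjTranspose_sub, hPh, conjTranspose_one, trace_mul_comm, ← mul_assoc]
    have : (1 - P) * (1 - P) = 1 - P := by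
      rw [mul_sub, sub_mul, sub_mul, hPP]; simp
    rw [this, sub_mul, one_mul, trace_sub]
  rw [← hP, e3] at h
  have h1 := (Complex.le_def.1 h).1
  rw [choiRe, ← hP, e1, e2]
  simpa using h1

end Necessity

theorem choiRe_depolarizing {d : ℕ} {X : Type*} [DecidableEq X] {v : X → Fin d → ℂ}
    (hon : ∀ x y, star (v x) ⬝ᵥ v y = if x = y then 1 else 0) (t : ℝ) (i j : X) :
    choiRe v (depolarizing d t) i j = t + if i = j then (1 - t) / d else 0 := by
  have e : star (v i) ⬝ᵥ (depolarizing d t (vecMulVec (v i) (star (v j))) *ᵥ v j) =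
      ((t + if i = j then (1 - t) / d else 0 : ℝ) : ℂ) := by
    rw [depolarizing_apply, trace_vecMulVec, dotProduct_comm (v i)]
    simp only [add_mulVec, smul_mulVec, vecMulVec_mulVec, one_mulVec, dotProduct_add,
      dotProduct_smul, op_smul_eq_smul, hon, smul_eq_mul]
    by_cases hij : i = j
    · subst hij
      simp
      ring
    · simp [hij, Ne.symm hij]
  rw [choiRe, e, Complex.ofReal_re]

theorem dotProduct_noisyMeter {d : ℕ} {X : Type*} [DecidableEq X]
    {Q : X → Matrix (Fin d) (Fin d) ℂ} {v : X → Fin d → ℂ}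
    (hv : ∀ x, Q x = vecMulVec (v x) (star (v x)))
    (hon : ∀ x y, star (v x) ⬝ᵥ v y = if x = y then 1 else 0) (s : ℝ) (x i : X) :
    (star (v i) ⬝ᵥ (noisyMeter Q s x *ᵥ v i)).re = (if i = x then s else 0) + (1 - s) / d := by
  have e : star (v i) ⬝ᵥ (noisyMeter Q s x *ᵥ v i) =
      (((if i = x then s else 0) + (1 - s) / d : ℝ) : ℂ) := by
    simp only [noisyMeter, hv, add_mulVec, smul_mulVec, vecMulVec_mulVec, one_mulVec,
      dotProduct_add, dotProduct_smul, op_smul_eq_smul, hon, smul_eq_mul]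
    by_cases hij : i = x
    · subst hij
      simp
      ring
    · simp [hij, Ne.symm hij]
      ring
  rw [e, Complex.ofReal_re]

/-- The linear trade-off inequalities, one for each `ν ≥ 0`; together they cut out the part
`s + t ≥ 1` of the compatibility region. -/
theorem IsSharpMeter.tradeoff {d : ℕ} (hd : 2 ≤ d) {X : Type*} [Fintype X]
    {Q : X → Matrix (Fin d) (Fin d) ℂ} (hQ : IsSharpMeter Q) {s t : ℝ}
    (h : MeterChannelCompatible (noisyMeter Q s) (depolarizing d t)) {ν : ℝ} (hν : 0 ≤ ν) :
    ν * d * t ≤ ν * (ν + d) * (1 - s) + (1 - t) := by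
  classical
  obtain ⟨J, ⟨hJ, -⟩, hM, hsum⟩ := h
  obtain ⟨v, hv, hon⟩ := hQ.exists_vectors
  have hcard : (Fintype.card X : ℝ) = d := by simpa using hQ.card_eq
  have hd2 : (2 : ℝ) ≤ d := by exact_mod_cast hd
  have hd0 : (d : ℝ) ≠ 0 := by linarith
  set μ := 1 + ν with hμ
  have hμ0 : 0 < μ := by linarith
  -- For outcome `x`, weight `1` on the index `x` and `μ` on the others.
  have hx : ∀ x, μ * ∑ i, ∑ j, choiRe v (J x) i j ≤
      (μ + (d - 1)) * (μ * ∑ i, choiRe v (J x) i i - ν * choiRe v (J x) x x) := by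
    intro x
    have h1 := sum_choiRe_le (v := v) (hJ x) (r := fun i => if i = x then 1 else μ)
      (fun i => by split_ifs <;> linarith)
    have e1 : ∑ j, (if j = x then 1 else μ)⁻¹ = 1 + (d - 1) / μ := by
      have : ∀ j, (if j = x then 1 else μ)⁻¹ = μ⁻¹ + if j = x then 1 - μ⁻¹ else 0 := fun j => by
        split_ifs <;> simp
      simp only [this, Finset.sum_add_distrib, Finset.sum_ite_eq', Finset.mem_univ, if_true,
        Finset.sum_const, Finset.card_univ, nsmul_eq_mul, hcard]
      ring
    have e2 : ∑ i, (if i = x then 1 else μ) * choiRe v (J x) i i =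
        μ * ∑ i, choiRe v (J x) i i - ν * choiRe v (J x) x x := by
      have : ∀ i, (if i = x then 1 else μ) * choiRe v (J x) i i =
          μ * choiRe v (J x) i i - if i = x then ν * choiRe v (J x) i i else 0 := fun i => by
        split_ifs
        · rw [hμ]; ring
        · ring
      simp only [this, Finset.sum_sub_distrib, Finset.sum_ite_eq', Finset.mem_univ, if_true,
        Finset.mul_sum]
    rw [e1, e2] at h1
    calc _ ≤ μ * _ := mul_le_mul_of_nonneg_left h1 hμ0.le
      _ = _ := by field_simp
  have hdiag : ∑ i, ∑ x, choiRe v (J x) i i = d * t + (1 - t) := by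
    simp only [← choiRe_sum, hsum, choiRe_depolarizing hon, if_true, Finset.sum_const,
      Finset.card_univ, nsmul_eq_mul, hcard]
    field_simp
  have hall : ∑ i, ∑ j, ∑ x, choiRe v (J x) i j = d ^ 2 * t + (1 - t) := by
    simp only [← choiRe_sum, hsum, choiRe_depolarizing hon, Finset.sum_add_distrib,
      Finset.sum_ite_eq, Finset.mem_univ, if_true, Finset.sum_const,
      Finset.card_univ, nsmul_eq_mul, hcard]
    field_simp
  -- The "wrong" diagonal entries are limited by the noise in the meter.
  have hE : d * t + (1 - t) - (d - 1) * (1 - s) ≤ ∑ x, choiRe v (J x) x x := by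
    have hb : ∀ x i, choiRe v (J x) i i ≤
        (1 - s) / d + if i = x then choiRe v (J x) x x - (1 - s) / d else 0 := by
      intro x i
      by_cases hix : i = x
      · subst hix; simp
      · have h1 := choiRe_diag_le (v := v) (hJ x) (i := i) (by rw [hon, if_pos rfl])
        rw [hM, dotProduct_noisyMeter hv hon] at h1
        simpa [hix] using h1
    have h2 := Finset.sum_le_sum fun x (_ : x ∈ Finset.univ) =>
      Finset.sum_le_sum fun i (_ : i ∈ Finset.univ) => hb x i
    rw [Finset.sum_comm, hdiag] at h2
    simp only [Finset.sum_add_distrib, Finset.sum_ite_eq', Finset.mem_univ, if_true,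
      Finset.sum_const, Finset.card_univ, nsmul_eq_mul, hcard, Finset.sum_sub_distrib] at h2
    have e : (d : ℝ) * ((1 - s) / d) = 1 - s := by field_simp
    rw [e] at h2
    linarith
  have htot := Finset.sum_le_sum fun x (_ : x ∈ Finset.univ) => hx x
  rw [← Finset.mul_sum, ← Finset.mul_sum, Finset.sum_sub_distrib, ← Finset.mul_sum,
    ← Finset.mul_sum, Finset.sum_comm, Finset.sum_congr rfl fun i _ => Finset.sum_comm, hall,
    Finset.sum_comm, hdiag] at htot
  have hfac : 0 ≤ (μ + (d - 1)) * ν := mul_nonneg (by linarith) hν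
  have hE' := mul_le_mul_of_nonneg_left hE hfac
  have hpos : (0 : ℝ) < d - 1 := by linarith
  have key : (d - 1) * (ν * d * t) ≤ (d - 1) * (ν * (ν + d) * (1 - s) + (1 - t)) := by
    rw [hμ] at htot hE'
    nlinarith
  exact le_of_mul_le_mul_left key hpos

theorem IsSharpMeter.le_of_meterChannelCompatible {d : ℕ} (hd : 2 ≤ d) {X : Type*} [Fintype X]
    {Q : X → Matrix (Fin d) (Fin d) ℂ} (hQ : IsSharpMeter Q) {s t : ℝ}
    (hs : s ≤ 1) (ht : t ≤ 1)
    (h : MeterChannelCompatible (noisyMeter Q s) (depolarizing d t)) :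
    s + t - 1 ≤ 2 / (d : ℝ) * √((1 - s) * (1 - t)) := by
  have hd0 : (0 : ℝ) < d := by exact_mod_cast (by omega : 0 < d)
  rcases le_or_gt (s + t - 1) 0 with hst | hst
  · exact hst.trans (by positivity)
  -- The quadratic in `ν` of the trade-off is nonnegative on all of `ℝ`, so its discriminant is
  -- nonpositive.
  have hq : ∀ ν : ℝ, 0 ≤ (1 - s) * (ν * ν) + (-(d * (s + t - 1))) * ν + (1 - t) := by
    intro ν
    rcases le_total 0 ν with hν | hν
    · linarith [hQ.tradeoff hd h hν]
    · have h1 : 0 ≤ d * (s + t - 1) * (-ν) :=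
        mul_nonneg (mul_pos hd0 hst).le (neg_nonneg.2 hν)
      have h2 : 0 ≤ (1 - s) * (ν * ν) := mul_nonneg (by linarith) (mul_self_nonneg ν)
      linarith
  have hdisc := discrim_le_zero hq
  rw [discrim] at hdisc
  have hsq : (d * (s + t - 1) / 2) ^ 2 ≤ (1 - s) * (1 - t) := by linarith
  have := Real.le_sqrt_of_sq_le hsq
  rw [div_mul_eq_mul_div, le_div_iff₀ hd0]
  linarith

end Qudit

theorem mainTheorem1 (d : ℕ) (hd : 2 ≤ d) {X : Type*} [Fintype X]
    (Q : X → Matrix (Fin d) (Fin d) ℂ) (hQ : Qudit.IsSharpMeter Q) :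
    (∀ s ∈ Set.Icc (0 : ℝ) 1, ∀ t ∈ Set.Icc (0 : ℝ) 1,
      (Qudit.MeterChannelCompatible (Qudit.noisyMeter Q s) (Qudit.depolarizing d t) ↔
        s + t - 1 ≤ 2 / (d : ℝ) * Real.sqrt ((1 - s) * (1 - t)))) ∧
    Qudit.regionMeterIdentity Q = Qudit.regionIdentityIdentity d := by
  have hd0 : d ≠ 0 := by omega
  have nec : ∀ s ∈ Set.Icc (0 : ℝ) 1, ∀ t ∈ Set.Icc (0 : ℝ) 1,
      Qudit.MeterChannelCompatible (Qudit.noisyMeter Q s) (Qudit.depolarizing d t) →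
        s + t - 1 ≤ 2 / (d : ℝ) * Real.sqrt ((1 - s) * (1 - t)) :=
    fun s hs t ht h => hQ.le_of_meterChannelCompatible hd hs.2 ht.2 h
  refine ⟨fun s hs t ht => ⟨nec s hs t ht, fun h =>
    hQ.meterChannelCompatible_of_channelsCompatible
      (Qudit.channelsCompatible_depolarizing hd0 hs ht h)⟩, ?_⟩
  ext ⟨s, t⟩
  exact ⟨fun ⟨hs, ht, h⟩ =>
      ⟨hs, ht, Qudit.channelsCompatible_depolarizing hd0 hs ht (nec s hs t ht h)⟩,
    fun ⟨hs, ht, h⟩ => ⟨hs, ht, hQ.meterChannelCompatible_of_channelsCompatible h⟩⟩
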